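/- **Notation.** $\|g\|=(\int_0^1|g(x)|^2dx)^{1/2}$; $u[t]=u(t,\cdot)$; a prime is the derivative in $x$. $H^1(0,1)$ is the space of absolutely continuous functions on $[0,1]$ with square integrable derivative. $PC^1([0,1])$ is the set of continuous functions on $[0,1]$ that have finite one-sided derivatives everywhere and are continuously differentiable on $(0,1)$ off a finite set. A *time sequence* is a strictly increasing sequence $\tau_0=0<\tau_1<\tau_2<\cdots$ with $\tau_i\to+\infty$; put $I=[0,+\infty)\setminus\{\tau_i: i\ge 0\}$. Let $p>0$, $q\in\mathbb R$, $(Ag)(x)=-pg''(x)+qg(x)$. **Class GD.** Let $D$ be the set of $g\in H^2(0,1)$ satisfying the Dirichlet conditions $g(0)=g(1)=0$ (respectively the Neumann conditions $g'(0)=g'(1)=0$). A function $f:[0,+\infty)\times[0,1]\to\mathbb R$ is of class GD with the time sequence $(\tau_i)$, for Dirichlet (respectively Neumann) conditions, if for every $i\ge1$ there are $f_1,f_2\in C^0((\tau_{i-1},\tau_i)\times[0,1])$, $a\in PC^1([0,1])$, $b\in C^0([0,1])$, $c\in D\cap C^2([0,1])$ such that for all $t\in(\tau_{i-1},\tau_i)$: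 $f_1[t]\in PC^1([0,1])$, $f_2[t]\in D\cap C^2([0,1])$, $f[t]=f_1[t]+f_2[t]$; moreover $$\sup_{\tau_{i-1}<t<\tau_i}\int_0^1\big(|f_1(t,x)|^2+|f_2(t,x)|^2+|(Af_2[t])(x)|^2\big)dx<+\infty ,$$ $\partial f_1/\partial t$ exists and is continuous on $(\tau_{i-1},\tau_i)\times[0,1]$, and $f_1(t,x)\to a(x)$, $\frac{\partial f_1}{\partial t}(t,x)\to b(x)$, $f_2(t,x)\to c(x)$ as $t\to\tau_i^-$, for every $x\in[0,1]$. **Class GB.** A right continuous $d:[0,+\infty)\to\mathbb R$ is of class GB if there is a time sequence such that $d\in C^2(I)$, the left limits of $d,\dot d,\ddot d$ at each $\tau_i>0$ are finite, and $\dot d$ is bounded on each $(\tau_i,\tau_{i+1})$. **Solution.** Let $f$ be of class GD with the time sequence $(\tau_i)$, for Dirichlet conditions. A solution of $$\frac{\partial u}{\partial t}=p\frac{\partial^2u}{\partial x^2}-qu+f,\qquad u(t,0)=u(t,1)=0,\qquad u[0]=u_0$$ is a function $u:[0,+\infty)\times[0,1]\to\mathbb R$ with $u\in C^0([0,+\infty);L^2(0,1))$,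 $u\in C^1(I\times[0,1])$, $u[t]\in C^2([0,1])$ for all $t>0$, such that for all $i\ge1$ and $x\in[0,1]$, as $t\to\tau_i^-$, $u(t,x)\to u(\tau_i,x)$, $u'(t,x)\to u'(\tau_i,x)$ and $\frac{\partial u}{\partial t}(t,x)\to-(Au[\tau_i])(x)+\lim_{s\to\tau_i^-}f(s,x)$, such that $u(0,x)=u_0(x)$ for all $x\in[0,1]$, the equation holds on $I\times(0,1)$, and the boundary conditions hold for $t\in I$. **Theorem 2.7.** Let $p>0$ and $q>-p\pi^2$. Let $u_0\in H^1(0,1)$ with $u_0(0)=u_0(1)=0$. Let $f$ be of class GD for Dirichlet conditions, with $f[t]\in C^1([0,1])$ for all $t\ge0$, with $f'$ of class GD (for Dirichlet or for Neumann conditions), and with $t\mapsto f(t,0)$, $t\mapsto f(t,1)$ of class GB. Then a solution $u$ of the above problem satisfies, for all $\sigma\in[0,p\pi^2+q)$ and $t>0$ (the suprema being finite), $$\|u[t]\|\le e^{-(p\pi^2+q)t}\|u_0\|+\frac{1}{p\pi^2+q-\sigma}\sup_{0<s<t}\big(\|f[s]\|e^{-\sigma(t-s)}\big),$$ $$\|u'[t]\|\le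 e^{-(p\pi^2+q)t}\|u_0'\|+\frac{p\pi^2+q}{p\pi^2+q-\sigma}\,p^{-1}h(q/p)\sup_{0<s<t}\big(\|f[s]\|e^{-\sigma(t-s)}\big),$$ where $$h(s)=\begin{cases}\dfrac{\sqrt{e^{2\sqrt s}-e^{-2\sqrt s}-4\sqrt s}}{2s^{1/4}(e^{\sqrt s}-e^{-\sqrt s})}&s>0,\\[2mm]\dfrac{\sqrt6}{6}&s=0,\\[2mm]\dfrac{\sqrt{4\sqrt{-s}-2\sin(2\sqrt{-s})}}{4(-s)^{1/4}\sin(\sqrt{-s})}&-\pi^2<s<0.\end{cases}$$ -/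

import Mathlib

open Set Filter Topology MeasureTheory

noncomputable section

namespace ParabolicSL

/-- The norm `‖g‖ = (∫₀¹ |g(x)|² dx)^{1/2}` of `L²(0,1)`. -/
def l2norm (g : ℝ → ℝ) : ℝ :=
  Real.sqrt (∫ x in (0 : ℝ)..1, |g x| ^ 2)

/-- The norm `‖g‖_r = (∫₀¹ r(x) |g(x)|² dx)^{1/2}` of the weighted space `L²_r(0,1)`. -/
def weightedNorm (r g : ℝ → ℝ) : ℝ :=
  Real.sqrt (∫ x in (0 : ℝ)..1, r x * |g x| ^ 2)

/-- The profile `g` lies in `L²(0,1)`. For a weight that is continuous and positive on `[0,1]`,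
`L²_r(0,1)` is the same set of functions. -/
def MemL2 (g : ℝ → ℝ) : Prop :=
  MemLp g 2 (volume.restrict (Ioo (0 : ℝ) 1))

/-- `H¹(0,1)`: absolutely continuous functions on `[0,1]` whose (a.e. defined) derivative is
square integrable. -/
def MemH1 (w : ℝ → ℝ) : Prop :=
  AbsolutelyContinuousOnInterval w 0 1 ∧ MemL2 (deriv w)

/-- The spatial derivative `f'(t,x)` on `[0,1]` (one-sided at the end points). -/
def spatialDeriv (f : ℝ → ℝ → ℝ) : ℝ → ℝ → ℝ :=
  fun t x => derivWithin (f t) (Icc 0 1) x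

/-- The class `PC¹([0,1])` of continuous, piecewise `C¹` functions. -/
structure IsPC1 (g : ℝ → ℝ) : Prop where
  continuousOn : ContinuousOn g (Icc 0 1)
  right : ∀ x ∈ Ico (0 : ℝ) 1, ∃ l, HasDerivWithinAt g l (Ioi x) x
  left : ∀ x ∈ Ioc (0 : ℝ) 1, ∃ l, HasDerivWithinAt g l (Iio x) x
  piecewise : ∃ S : Set ℝ, S.Finite ∧ S ⊆ Ioo 0 1 ∧
    (∀ x ∈ Ioo (0 : ℝ) 1 \ S, DifferentiableAt ℝ g x) ∧
    ContinuousOn (deriv g) (Ioo 0 1 \ S)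

/-- The data of a regular Sturm-Liouville operator on `[0,1]`: coefficients `p, r, q` and the
boundary conditions `b₁ g(0) + b₂ g'(0) = 0 = a₁ g(1) + a₂ g'(1)`. -/
structure SLOperator where
  p : ℝ → ℝ
  r : ℝ → ℝ
  q : ℝ → ℝ
  a₁ : ℝ
  a₂ : ℝ
  b₁ : ℝ
  b₂ : ℝ
  p_smooth : ContDiffOn ℝ 1 p (Icc 0 1)
  p_pos : ∀ x ∈ Icc (0 : ℝ) 1, 0 < p x
  r_cont : ContinuousOn r (Icc 0 1)
  r_pos : ∀ x ∈ Icc (0 : ℝ) 1, 0 < r x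
  q_cont : ContinuousOn q (Icc 0 1)
  a_ne : 0 < |a₁| + |a₂|
  b_ne : 0 < |b₁| + |b₂|

namespace SLOperator

/-- `(A g)(x) = -(1/r(x)) (p g')'(x) + (q(x)/r(x)) g(x)`. -/
def apply (A : SLOperator) (g : ℝ → ℝ) (x : ℝ) : ℝ :=
  -(1 / A.r x) * derivWithin (fun y => A.p y * derivWithin g (Icc 0 1) y) (Icc 0 1) x
    + A.q x / A.r x * g x

/-- The boundary functional `b₁ g(0) + b₂ g'(0)`. -/
def bdry0 (A : SLOperator) (g : ℝ → ℝ) : ℝ :=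
  A.b₁ * g 0 + A.b₂ * derivWithin g (Icc 0 1) 0

/-- The boundary functional `a₁ g(1) + a₂ g'(1)`. -/
def bdry1 (A : SLOperator) (g : ℝ → ℝ) : ℝ :=
  A.a₁ * g 1 + A.a₂ * derivWithin g (Icc 0 1) 1

/-- `g ∈ D ∩ C²([0,1])`, where `D ⊆ H²(0,1)` is the domain of `A`, that is, the set of functions
in `H²(0,1)` that satisfy the homogeneous boundary conditions. -/
def MemDomC2 (A : SLOperator) (g : ℝ → ℝ) : Prop :=
  ContDiffOn ℝ 2 g (Icc 0 1) ∧ A.bdry0 g = 0 ∧ A.bdry1 g = 0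

end SLOperator

/-- An increasing sequence of times with `τ₀ = 0` and `τᵢ → +∞`. -/
def IsTimeSeq (τ : ℕ → ℝ) : Prop :=
  StrictMono τ ∧ τ 0 = 0 ∧ Tendsto τ atTop atTop

/-- `I = [0,+∞) \ {τᵢ : i = 0,1,2,…}`. -/
def regularTimes (τ : ℕ → ℝ) : Set ℝ :=
  Ici 0 \ range τ

/-- The decomposition `f = f₁ + f₂` on the strip `(s, T) × [0,1]` that the class `GD` requires. -/
structure IsGDOn (A : SLOperator) (s T : ℝ) (f f₁ f₂ : ℝ → ℝ → ℝ) (a b c : ℝ → ℝ) : Prop where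
  f₁_cont : ContinuousOn (fun z : ℝ × ℝ => f₁ z.1 z.2) (Ioo s T ×ˢ Icc 0 1)
  f₂_cont : ContinuousOn (fun z : ℝ × ℝ => f₂ z.1 z.2) (Ioo s T ×ˢ Icc 0 1)
  a_pc1 : IsPC1 a
  b_cont : ContinuousOn b (Icc 0 1)
  c_dom : A.MemDomC2 c
  f₁_pc1 : ∀ t ∈ Ioo s T, IsPC1 (f₁ t)
  f₂_dom : ∀ t ∈ Ioo s T, A.MemDomC2 (f₂ t)
  sum_eq : ∀ t ∈ Ioo s T, ∀ x ∈ Icc (0 : ℝ) 1, f t x = f₁ t x + f₂ t x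
  bound : ∃ M : ℝ, ∀ t ∈ Ioo s T,
    ∫ x in (0 : ℝ)..1, A.r x * (|f₁ t x| ^ 2 + |f₂ t x| ^ 2 + |A.apply (f₂ t) x| ^ 2) ≤ M
  dt_exists : ∀ t ∈ Ioo s T, ∀ x ∈ Icc (0 : ℝ) 1, DifferentiableAt ℝ (fun t' => f₁ t' x) t
  dt_cont : ContinuousOn (fun z : ℝ × ℝ => deriv (fun t' => f₁ t' z.2) z.1)
    (Ioo s T ×ˢ Icc 0 1)
  lim_f₁ : ∀ x ∈ Icc (0 : ℝ) 1, Tendsto (fun t => f₁ t x) (𝓝[<] T) (𝓝 (a x))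
  lim_dt : ∀ x ∈ Icc (0 : ℝ) 1,
    Tendsto (fun t => deriv (fun t' => f₁ t' x) t) (𝓝[<] T) (𝓝 (b x))
  lim_f₂ : ∀ x ∈ Icc (0 : ℝ) 1, Tendsto (fun t => f₂ t x) (𝓝[<] T) (𝓝 (c x))

/-- `f` is of class `GD` (for the operator `A`) with the sequence of times `τ`. -/
def IsGDWith (A : SLOperator) (τ : ℕ → ℝ) (f : ℝ → ℝ → ℝ) : Prop :=
  IsTimeSeq τ ∧ ∀ i : ℕ, ∃ (f₁ f₂ : ℝ → ℝ → ℝ) (a b c : ℝ → ℝ),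
    IsGDOn A (τ i) (τ (i + 1)) f f₁ f₂ a b c

/-- The class `GD` of distributed inputs on `[0,+∞) × [0,1]`, for the operator `A`. -/
def IsGD (A : SLOperator) (f : ℝ → ℝ → ℝ) : Prop :=
  ∃ τ, IsGDWith A τ f

/-- The class `GB` of boundary inputs on `[0,+∞)`. -/
def IsGB (d : ℝ → ℝ) : Prop :=
  (∀ t, 0 ≤ t → ContinuousWithinAt d (Ici t) t) ∧
  ∃ τ, IsTimeSeq τ ∧
    ContDiffOn ℝ 2 d (regularTimes τ) ∧
    (∀ i, 0 < τ i →
      (∃ l, Tendsto d (𝓝[<] τ i) (𝓝 l)) ∧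
      (∃ l, Tendsto (deriv d) (𝓝[<] τ i) (𝓝 l)) ∧
      (∃ l, Tendsto (deriv (deriv d)) (𝓝[<] τ i) (𝓝 l))) ∧
    (∀ i, ∃ M, ∀ t ∈ Ioo (τ i) (τ (i + 1)), |deriv d t| ≤ M)

/-- `u` is a solution of the evolution equation
`∂u/∂t + A u = f`, `b₁ u(t,0) + b₂ u'(t,0) = d₀(t)`, `a₁ u(t,1) + a₂ u'(t,1) = d₁(t)`
with `u[0] = u₀`, for the sequence of times `τ` of the inputs. -/
structure IsSolution (A : SLOperator) (τ : ℕ → ℝ) (f : ℝ → ℝ → ℝ) (d₀ d₁ : ℝ → ℝ) (u₀ : ℝ → ℝ)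
    (u : ℝ → ℝ → ℝ) : Prop where
  memL2 : ∀ t, 0 ≤ t → MemL2 (u t)
  contL2 : ∀ t, 0 ≤ t →
    Tendsto (fun s => weightedNorm A.r (fun x => u s x - u t x)) (𝓝[Ici 0] t) (𝓝 0)
  contDiff : ContDiffOn ℝ 1 (fun z : ℝ × ℝ => u z.1 z.2) (regularTimes τ ×ˢ Icc 0 1)
  profile : ∀ t, 0 < t → ContDiffOn ℝ 2 (u t) (Icc 0 1)
  lim_u : ∀ i, 1 ≤ i → ∀ x ∈ Icc (0 : ℝ) 1,
    Tendsto (fun t => u t x) (𝓝[<] τ i) (𝓝 (u (τ i) x))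
  lim_dt : ∀ i, 1 ≤ i → ∀ x ∈ Icc (0 : ℝ) 1, ∃ l,
    Tendsto (fun t => f t x) (𝓝[<] τ i) (𝓝 l) ∧
    Tendsto (fun t => deriv (fun t' => u t' x) t) (𝓝[<] τ i) (𝓝 (-A.apply (u (τ i)) x + l))
  lim_dx : ∀ i, 1 ≤ i → ∀ x ∈ Icc (0 : ℝ) 1,
    Tendsto (fun t => spatialDeriv u t x) (𝓝[<] τ i) (𝓝 (spatialDeriv u (τ i) x))
  init : ∀ x ∈ Icc (0 : ℝ) 1, u 0 x = u₀ x
  pde : ∀ t ∈ regularTimes τ, ∀ x ∈ Ioo (0 : ℝ) 1,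
    deriv (fun t' => u t' x) t + A.apply (u t) x = f t x
  bc0 : ∀ t ∈ regularTimes τ, A.bdry0 (u t) - d₀ t = 0
  bc1 : ∀ t ∈ regularTimes τ, A.bdry1 (u t) - d₁ t = 0

/-- Constant coefficients `p, q`, `r ≡ 1` and Dirichlet conditions `g(0) = g(1) = 0`. -/
def dirichletOp (p q : ℝ) (hp : 0 < p) : SLOperator where
  p := fun _ => p
  r := fun _ => 1
  q := fun _ => q
  a₁ := 1
  a₂ := 0
  b₁ := 1
  b₂ := 0
  p_smooth := contDiffOn_const
  p_pos := fun _ _ => hp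
  r_cont := continuousOn_const
  r_pos := fun _ _ => one_pos
  q_cont := continuousOn_const
  a_ne := by norm_num
  b_ne := by norm_num

/-- Constant coefficients `p, q`, `r ≡ 1` and Neumann conditions `g'(0) = g'(1) = 0`. -/
def neumannOp (p q : ℝ) (hp : 0 < p) : SLOperator where
  p := fun _ => p
  r := fun _ => 1
  q := fun _ => q
  a₁ := 0
  a₂ := 1
  b₁ := 0
  b₂ := 1
  p_smooth := contDiffOn_const
  p_pos := fun _ _ => hp
  r_cont := continuousOn_const
  r_pos := fun _ _ => one_pos
  q_cont := continuousOn_const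
  a_ne := by norm_num
  b_ne := by norm_num

/-- The gain function `h`, meant for arguments `s > -π²`. -/
def gain (s : ℝ) : ℝ :=
  if 0 < s then
    Real.sqrt (Real.exp (2 * Real.sqrt s) - Real.exp (-(2 * Real.sqrt s)) - 4 * Real.sqrt s) /
      (2 * s ^ (1 / 4 : ℝ) * (Real.exp (Real.sqrt s) - Real.exp (-Real.sqrt s)))
  else if s = 0 then Real.sqrt 6 / 6
  else
    Real.sqrt (4 * Real.sqrt (-s) - 2 * Real.sin (2 * Real.sqrt (-s))) /
      (4 * (-s) ^ (1 / 4 : ℝ) * Real.sin (Real.sqrt (-s)))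

/-- The quantities `‖f[s]‖ exp(-σ(t-s))`, `0 < s < t`. -/
def fadingValues (f : ℝ → ℝ → ℝ) (σ t : ℝ) : Set ℝ :=
  (fun s => l2norm (f s) * Real.exp (-σ * (t - s))) '' Ioo 0 t

end ParabolicSL

end

/-
In the orthonormal basis `√2 sin(nπx)` the equation decouples into `ŷₙ' = -λₙ ŷₙ + f̂ₙ` with
`λₙ = p(nπ)² + q`. The homogeneous part decays at least like `exp(-λ₁ t)`, both in `L²` and, after
weighting the modes with `nπ`, in `H¹`. The vector of forced parts is bounded in `ℓ²` by
`S / (λ₁ - σ)`, where `S` is the supremum of the fading values, because the semigroup contracts at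
the rate `λ₁`. For the derivative each forced mode is bounded separately by
`S / (λₙ - σ) ≤ λ₁ / (λ₁ - σ) * S / λₙ`, and the `ℓ²` norm of `nπ / λₙ` is `h(q/p) / p`: by
Parseval, `Σ (nπ / ((nπ)² + s))²` is half the squared `L²` norm of the solution of `g'' = s g`,
`g(0) = 1`, `g(1) = 0`, which is computed explicitly.
-/

namespace ParabolicSL

open Real

theorem l2norm_nonneg (g : ℝ → ℝ) : 0 ≤ l2norm g :=
  sqrt_nonneg _

theorem l2norm_sq (g : ℝ → ℝ) : l2norm g ^ 2 = ∫ x in (0 : ℝ)..1, |g x| ^ 2 :=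
  sq_sqrt (intervalIntegral.integral_nonneg zero_le_one fun _ _ => by positivity)

theorem integral_zero_one_congr {E : Type*} [NormedAddCommGroup E] [NormedSpace ℝ E]
    {f g : ℝ → E} (h : EqOn f g (Ioo 0 1)) :
    ∫ x in (0 : ℝ)..1, f x = ∫ x in (0 : ℝ)..1, g x := by
  simp only [intervalIntegral.integral_of_le zero_le_one, integral_Ioc_eq_integral_Ioo]
  exact setIntegral_congr_fun measurableSet_Ioo h

theorem l2norm_congr {f g : ℝ → ℝ} (h : EqOn f g (Ioo 0 1)) : l2norm f = l2norm g :=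
  congrArg sqrt (integral_zero_one_congr fun x hx => by simp only [h hx])

theorem memL2_of_continuousOn {g : ℝ → ℝ} (hg : ContinuousOn g (Icc 0 1)) : MemL2 g := by
  obtain ⟨C, hC⟩ := isCompact_Icc.exists_bound_of_continuousOn hg
  refine MemLp.of_bound
    ((hg.mono Ioo_subset_Icc_self).aestronglyMeasurable measurableSet_Ioo) C ?_
  filter_upwards [ae_restrict_mem measurableSet_Ioo] with x hx
  exact hC x (Ioo_subset_Icc_self hx)

theorem MemL2.congr {f g : ℝ → ℝ} (hf : MemL2 f) (h : EqOn f g (Ioo 0 1)) : MemL2 g :=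
  MemLp.ae_eq ((ae_restrict_mem measurableSet_Ioo).mono h) hf

theorem MemL2.intervalIntegrable {g : ℝ → ℝ} (hg : MemL2 g) :
    IntervalIntegrable g volume 0 1 := by
  rw [intervalIntegrable_iff_integrableOn_Ioo_of_le zero_le_one]
  exact hg.integrable one_le_two

/-- The reflection of `g|_(0,1)` to `(-1,1)`: even for `ε = 1`, odd for `ε = -1`. Its Fourier
series is the cosine, respectively the sine, series of `g`. -/
noncomputable def reflected (ε : ℝ) (g : ℝ → ℝ) (x : ℝ) : ℝ :=
  (Ioo (0 : ℝ) 1).indicator g x + ε * (Ioo (0 : ℝ) 1).indicator g (-x)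

theorem memLp_reflected (ε : ℝ) {g : ℝ → ℝ} (hg : MemL2 g) : MemLp (reflected ε g) 2 volume := by
  have h : MemLp ((Ioo (0 : ℝ) 1).indicator g) 2 volume :=
    (memLp_indicator_iff_restrict measurableSet_Ioo).2 hg
  exact h.add ((h.comp_measurePreserving (Measure.measurePreserving_neg volume)).const_mul ε)

theorem reflected_of_mem (ε : ℝ) (g : ℝ → ℝ) {x : ℝ} (hx : x ∈ Ioo (0 : ℝ) 1) :
    reflected ε g x = g x := by
  have : -x ∉ Ioo (0 : ℝ) 1 := fun h => by linarith [h.1, hx.1]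
  simp [reflected, hx, indicator_of_notMem this]

theorem reflected_neg_of_mem (ε : ℝ) (g : ℝ → ℝ) {x : ℝ} (hx : x ∈ Ioo (0 : ℝ) 1) :
    reflected ε g (-x) = ε * g x := by
  have : -x ∉ Ioo (0 : ℝ) 1 := fun h => by linarith [h.1, hx.1]
  simp [reflected, hx, indicator_of_notMem this]

theorem integral_neg_self_eq_integral_add_comp_neg {E : Type*} [NormedAddCommGroup E]
    [NormedSpace ℝ E] {F : ℝ → E} {a : ℝ} (ha : 0 ≤ a) (hF : IntervalIntegrable F volume (-a) a) :
    ∫ x in (-a)..a, F x = ∫ x in (0 : ℝ)..a, (F x + F (-x)) := by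
  have hmem : 0 ∈ uIcc (-a) a := mem_uIcc_of_le (neg_nonpos.2 ha) ha
  have hleft : IntervalIntegrable F volume (-a) 0 := hF.mono_set (uIcc_subset_uIcc_left hmem)
  have hright : IntervalIntegrable F volume 0 a := hF.mono_set (uIcc_subset_uIcc_right hmem)
  have hneg : IntervalIntegrable (fun x => F (-x)) volume 0 a := by
    simpa using (hleft.comp_sub_left 0).symm
  rw [intervalIntegral.integral_add hright hneg, intervalIntegral.integral_comp_neg,
    ← intervalIntegral.integral_add_adjacent_intervals hleft hright, neg_zero, add_comm]

/-- The complex Fourier coefficients on `(-1,1)` of the reflection of `g|_(0,1)`. -/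
noncomputable def reflectedCoeff (ε : ℝ) (g : ℝ → ℝ) (m : ℤ) : ℂ :=
  fourierCoeffOn (neg_lt_self one_pos) (fun x => (reflected ε g x : ℂ)) m

theorem reflectedCoeff_eq (ε : ℝ) {g : ℝ → ℝ} (hg : MemL2 g) (m : ℤ) :
    reflectedCoeff ε g m =
      ((1 + ε) / 2 * ∫ x in (0 : ℝ)..1, g x * cos (m * π * x) : ℝ) -
        ((1 - ε) / 2 * ∫ x in (0 : ℝ)..1, g x * sin (m * π * x) : ℝ) * Complex.I := by
  have hint : IntervalIntegrable (fun x => (reflected ε g x : ℂ)) volume (-1) 1 := by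
    rw [intervalIntegrable_iff_integrableOn_Ioc_of_le (by norm_num)]
    exact (((memLp_reflected ε hg).restrict _).integrable one_le_two).ofReal
  have hexp (x : ℝ) : (fourier (-m) (x : AddCircle ((1 : ℝ) - -1)) : ℂ) =
      cos (m * π * x) - sin (m * π * x) * Complex.I := by
    rw [fourier_coe_apply, show 2 * π * Complex.I * ((-m : ℤ) : ℂ) * x / ((1 - -1 : ℝ) : ℂ) =
      ((-(m * π * x) : ℝ) : ℂ) * Complex.I by push_cast; ring, Complex.exp_mul_I]
    simp [sub_eq_add_neg]
  have hofReal {w : ℝ → ℝ} (c : ℝ) (hw : Continuous w) :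
      IntervalIntegrable (fun x => ((c * (g x * w x) : ℝ) : ℂ)) volume 0 1 :=
    have h := (hg.intervalIntegrable.mul_continuousOn hw.continuousOn).const_mul c
    ⟨h.1.ofReal, h.2.ofReal⟩
  rw [reflectedCoeff, fourierCoeffOn_eq_integral]
  simp only [hexp, smul_eq_mul]
  rw [integral_neg_self_eq_integral_add_comp_neg zero_le_one
    (hint.continuousOn_mul (by fun_prop)),
    integral_zero_one_congr (g := fun x => (((1 + ε) * (g x * cos (m * π * x)) : ℝ) : ℂ) -
      (((1 - ε) * (g x * sin (m * π * x)) : ℝ) : ℂ) * Complex.I),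
    intervalIntegral.integral_sub (hofReal _ (by fun_prop))
      ((hofReal _ (by fun_prop)).mul_const _),
    intervalIntegral.integral_mul_const, intervalIntegral.integral_ofReal,
    intervalIntegral.integral_ofReal, intervalIntegral.integral_const_mul,
    intervalIntegral.integral_const_mul, Complex.real_smul]
  · push_cast
    ring
  · intro x hx
    simp only [reflected_of_mem ε g hx, reflected_neg_of_mem ε g hx, mul_neg, cos_neg, sin_neg]
    push_cast
    ring

theorem integral_sq_norm_reflected {ε : ℝ} (hε : ε ^ 2 = 1) {g : ℝ → ℝ} (hg : MemL2 g) :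
    ∫ x in (-1 : ℝ)..1, ‖(reflected ε g x : ℂ)‖ ^ 2 = 2 * l2norm g ^ 2 := by
  simp only [Complex.norm_real, norm_eq_abs, sq_abs, l2norm_sq]
  have hint : IntervalIntegrable (fun x => reflected ε g x ^ 2) volume (-1) 1 := by
    rw [intervalIntegrable_iff_integrableOn_Ioc_of_le (by norm_num)]
    exact ((memLp_reflected ε hg).restrict _).integrable_sq
  rw [integral_neg_self_eq_integral_add_comp_neg zero_le_one hint,
    ← intervalIntegral.integral_const_mul]
  refine integral_zero_one_congr fun x hx => ?_
  simp only [reflected_of_mem ε g hx, reflected_neg_of_mem ε g hx, mul_pow, hε]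
  ring

theorem hasSum_sq_norm_reflectedCoeff {ε : ℝ} (hε : ε ^ 2 = 1) {g : ℝ → ℝ} (hg : MemL2 g) :
    HasSum (fun m => ‖reflectedCoeff ε g m‖ ^ 2) (l2norm g ^ 2) := by
  convert hasSum_sq_fourierCoeffOn (neg_lt_self one_pos) (f := fun x => (reflected ε g x : ℂ))
    ((memLp_reflected ε hg).restrict _).ofReal using 1
  · rfl
  · rw [integral_sq_norm_reflected hε hg, smul_eq_mul]
    ring

theorem hasSum_two_mul_nat_add_one_of_even {F : ℤ → ℝ} {S : ℝ} (hF : ∀ m, F (-m) = F m)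
    (hS : HasSum F S) : HasSum (fun n : ℕ => 2 * F (n + 1)) (S - F 0) := by
  have h := hS.nat_add_neg
  simp only [hF, ← two_mul] at h
  have h' := (hasSum_nat_add_iff' 1).2 h
  rw [Finset.sum_range_one, Nat.cast_zero, two_mul, add_sub_add_right_eq_sub] at h'
  exact_mod_cast h'

/-- The frequencies `nπ`, `n ≥ 1`, of the Dirichlet Laplacian on `(0,1)`, indexed from `0`. -/
noncomputable def frequency (n : ℕ) : ℝ :=
  (n + 1) * π

/-- The coefficients of `g` in the orthonormal basis `√2 sin(nπx)`, `n ≥ 1`, of `L²(0,1)`. -/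
noncomputable def sinCoeff (g : ℝ → ℝ) (n : ℕ) : ℝ :=
  √2 * ∫ x in (0 : ℝ)..1, g x * sin (frequency n * x)

/-- The coefficients of `g` in the orthonormal system `√2 cos(nπx)`, `n ≥ 1`, of `L²(0,1)`; the
mean value of `g` is not among them. -/
noncomputable def cosCoeff (g : ℝ → ℝ) (n : ℕ) : ℝ :=
  √2 * ∫ x in (0 : ℝ)..1, g x * cos (frequency n * x)

theorem MemL2.hasSum_sinCoeff_sq {g : ℝ → ℝ} (hg : MemL2 g) :
    HasSum (fun n => sinCoeff g n ^ 2) (l2norm g ^ 2) := by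
  have h := hasSum_sq_norm_reflectedCoeff (ε := -1) (by norm_num) hg
  have hnorm (m : ℤ) : ‖reflectedCoeff (-1) g m‖ ^ 2 =
      (∫ x in (0 : ℝ)..1, g x * sin (m * π * x)) ^ 2 := by
    rw [reflectedCoeff_eq _ hg]
    norm_num [Complex.norm_real, -Complex.ofReal_sub]
  simp only [hnorm] at h
  convert hasSum_two_mul_nat_add_one_of_even (fun m => ?_) h using 1
  · ext n
    simp [sinCoeff, frequency, mul_pow]
  · simp
  · simp [intervalIntegral.integral_neg]

theorem MemL2.hasSum_cosCoeff_sq {g : ℝ → ℝ} (hg : MemL2 g) (hmean : ∫ x in (0 : ℝ)..1, g x = 0) :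
    HasSum (fun n => cosCoeff g n ^ 2) (l2norm g ^ 2) := by
  have h := hasSum_sq_norm_reflectedCoeff (ε := 1) (by norm_num) hg
  have hnorm (m : ℤ) : ‖reflectedCoeff 1 g m‖ ^ 2 =
      (∫ x in (0 : ℝ)..1, g x * cos (m * π * x)) ^ 2 := by
    rw [reflectedCoeff_eq _ hg]
    norm_num [Complex.norm_real, -Complex.ofReal_sub]
  simp only [hnorm] at h
  convert hasSum_two_mul_nat_add_one_of_even (fun m => ?_) h using 1
  · ext n
    simp [cosCoeff, frequency, mul_pow]
  · simp [hmean]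
  · simp

theorem sinCoeff_congr {f g : ℝ → ℝ} (h : EqOn f g (Ioo 0 1)) (n : ℕ) :
    sinCoeff f n = sinCoeff g n :=
  congrArg (√2 * ·) (integral_zero_one_congr fun x hx => by simp only [h hx])

theorem cosCoeff_congr {f g : ℝ → ℝ} (h : EqOn f g (Ioo 0 1)) (n : ℕ) :
    cosCoeff f n = cosCoeff g n :=
  congrArg (√2 * ·) (integral_zero_one_congr fun x hx => by simp only [h hx])

theorem sinCoeff_add {f g : ℝ → ℝ} (hf : MemL2 f) (hg : MemL2 g) (n : ℕ) :
    sinCoeff (fun x => f x + g x) n = sinCoeff f n + sinCoeff g n := by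
  simp only [sinCoeff, ← mul_add, add_mul]
  rw [intervalIntegral.integral_add (hf.intervalIntegrable.mul_continuousOn (by fun_prop))
    (hg.intervalIntegrable.mul_continuousOn (by fun_prop))]

theorem sinCoeff_const_mul (c : ℝ) (g : ℝ → ℝ) (n : ℕ) :
    sinCoeff (fun x => c * g x) n = c * sinCoeff g n := by
  simp only [sinCoeff, mul_assoc, intervalIntegral.integral_const_mul]
  ring

theorem sinCoeff_sub {f g : ℝ → ℝ} (hf : MemL2 f) (hg : MemL2 g) (n : ℕ) :
    sinCoeff (fun x => f x - g x) n = sinCoeff f n - sinCoeff g n := by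
  have h := sinCoeff_add hf (hg.const_mul (-1)) n
  rw [sinCoeff_const_mul, neg_one_mul] at h
  simpa only [neg_one_mul, ← sub_eq_add_neg] using h

theorem MemL2.abs_sinCoeff_le {g : ℝ → ℝ} (hg : MemL2 g) (n : ℕ) : |sinCoeff g n| ≤ l2norm g :=
  abs_le_of_sq_le_sq (le_hasSum hg.hasSum_sinCoeff_sq n fun _ _ => sq_nonneg _) (l2norm_nonneg g)

theorem sin_frequency (n : ℕ) : sin (frequency n) = 0 := by
  simpa [frequency] using sin_nat_mul_pi (n + 1)

theorem hasDerivAt_sin_const_mul (ω x : ℝ) :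
    HasDerivAt (fun x => sin (ω * x)) (ω * cos (ω * x)) x := by
  simpa [mul_comm] using ((hasDerivAt_id x).const_mul ω).sin

theorem hasDerivAt_cos_const_mul (ω x : ℝ) :
    HasDerivAt (fun x => cos (ω * x)) (-(ω * sin (ω * x))) x := by
  simpa [mul_comm] using ((hasDerivAt_id x).const_mul ω).cos

section IntegrationByParts

variable {g : ℝ → ℝ} (hg : AbsolutelyContinuousOnInterval g 0 1)
include hg

theorem sinCoeff_deriv (n : ℕ) : sinCoeff (deriv g) n = -(frequency n * cosCoeff g n) := by
  have hsin : AbsolutelyContinuousOnInterval (fun x => sin (frequency n * x)) 0 1 :=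
    ContDiffOn.absolutelyContinuousOnInterval (by fun_prop)
  simp only [sinCoeff, cosCoeff, mul_comm _ (sin _), hsin.integral_mul_deriv_eq_deriv_mul hg,
    (hasDerivAt_sin_const_mul _ _).deriv, mul_one, mul_zero, sin_frequency, sin_zero, mul_assoc,
    intervalIntegral.integral_const_mul]
  simp only [mul_comm (g _)]
  ring

theorem cosCoeff_deriv (h1 : g 1 = 0) (n : ℕ) :
    cosCoeff (deriv g) n = frequency n * sinCoeff g n - √2 * g 0 := by
  have hcos : AbsolutelyContinuousOnInterval (fun x => cos (frequency n * x)) 0 1 :=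
    ContDiffOn.absolutelyContinuousOnInterval (by fun_prop)
  simp only [sinCoeff, cosCoeff, mul_comm _ (cos _), hcos.integral_mul_deriv_eq_deriv_mul hg,
    (hasDerivAt_cos_const_mul _ _).deriv, mul_zero, cos_zero, h1, mul_assoc, neg_mul,
    intervalIntegral.integral_const_mul, intervalIntegral.integral_neg]
  simp only [mul_comm (g _)]
  ring

end IntegrationByParts

theorem MemH1.hasSum_frequency_mul_sinCoeff_sq {g : ℝ → ℝ} (hg : MemH1 g) (h0 : g 0 = 0)
    (h1 : g 1 = 0) :
    HasSum (fun n => (frequency n * sinCoeff g n) ^ 2) (l2norm (deriv g) ^ 2) := by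
  have hmean : ∫ x in (0 : ℝ)..1, deriv g x = 0 := by
    rw [hg.1.integral_deriv_eq_sub, h0, h1, sub_zero]
  simpa [cosCoeff_deriv hg.1 h1, h0] using hg.2.hasSum_cosCoeff_sq hmean

theorem eqOn_derivWithin_Icc (g : ℝ → ℝ) (a b : ℝ) :
    EqOn (derivWithin g (Icc a b)) (deriv g) (Ioo a b) := fun _ hx =>
  derivWithin_of_mem_nhds (Icc_mem_nhds hx.1 hx.2)

theorem memH1_of_contDiffOn {g : ℝ → ℝ} (hg : ContDiffOn ℝ 1 g (Icc 0 1)) : MemH1 g :=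
  ⟨ContDiffOn.absolutelyContinuousOnInterval (by rwa [uIcc_of_le zero_le_one]),
    (memL2_of_continuousOn (hg.continuousOn_derivWithin (uniqueDiffOn_Icc one_pos) le_rfl)).congr
      (eqOn_derivWithin_Icc g 0 1)⟩

theorem sinCoeff_derivWithin_derivWithin {g : ℝ → ℝ} (hg : ContDiffOn ℝ 2 g (Icc 0 1))
    (h0 : g 0 = 0) (h1 : g 1 = 0) (n : ℕ) :
    sinCoeff (derivWithin (derivWithin g (Icc 0 1)) (Icc 0 1)) n =
      -(frequency n ^ 2 * sinCoeff g n) := by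
  have hg' : ContDiffOn ℝ 1 (derivWithin g (Icc 0 1)) (Icc 0 1) :=
    hg.derivWithin (uniqueDiffOn_Icc one_pos) (by norm_num)
  rw [sinCoeff_congr (eqOn_derivWithin_Icc _ 0 1), sinCoeff_deriv (memH1_of_contDiffOn hg').1,
    cosCoeff_congr (eqOn_derivWithin_Icc _ 0 1),
    cosCoeff_deriv (memH1_of_contDiffOn (hg.of_le one_le_two)).1 h1, h0]
  ring

theorem pi_le_frequency (n : ℕ) : π ≤ frequency n :=
  le_mul_of_one_le_left pi_pos.le (by linarith [n.cast_nonneg (α := ℝ)])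

theorem frequency_pos (n : ℕ) : 0 < frequency n :=
  pi_pos.trans_le (pi_le_frequency n)

theorem pi_sq_le_frequency_sq (n : ℕ) : π ^ 2 ≤ frequency n ^ 2 :=
  pow_le_pow_left₀ pi_pos.le (pi_le_frequency n) 2

section Resolvent

variable {s : ℝ} {g g' : ℝ → ℝ} (hg : ∀ x, HasDerivAt g (g' x) x)
  (hg' : ∀ x, HasDerivAt g' (s * g x) x)
include hg hg'

theorem hasSum_frequency_div_sq (hs : -π ^ 2 < s) (h0 : g 0 = 1) (h1 : g 1 = 0) :
    HasSum (fun n => (frequency n / (frequency n ^ 2 + s)) ^ 2)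
      ((∫ x in (0 : ℝ)..1, g x ^ 2) / 2) := by
  have hderiv : deriv g = g' := funext fun x => (hg x).deriv
  have hderiv' : deriv g' = fun x => s * g x := funext fun x => (hg' x).deriv
  have cg : Continuous g := continuous_iff_continuousAt.2 fun x => (hg x).continuousAt
  have cg' : Continuous g' := continuous_iff_continuousAt.2 fun x => (hg' x).continuousAt
  have hac : AbsolutelyContinuousOnInterval g 0 1 := ContDiffOn.absolutelyContinuousOnInterval
    (contDiff_one_iff_deriv.2 ⟨fun x => (hg x).differentiableAt, hderiv ▸ cg'⟩).contDiffOn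
  have hac' : AbsolutelyContinuousOnInterval g' 0 1 := ContDiffOn.absolutelyContinuousOnInterval
    (contDiff_one_iff_deriv.2 ⟨fun x => (hg' x).differentiableAt,
      hderiv' ▸ continuous_const.mul cg⟩).contDiffOn
  have hcoeff (n : ℕ) : sinCoeff g n = √2 * (frequency n / (frequency n ^ 2 + s)) := by
    have hsin := sinCoeff_deriv hac' n
    have hcos := cosCoeff_deriv hac h1 n
    rw [hderiv', sinCoeff_const_mul] at hsin
    rw [hderiv, h0] at hcos
    have hpos : 0 < frequency n ^ 2 + s := by linarith [pi_sq_le_frequency_sq n]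
    field_simp
    linear_combination hsin - frequency n * hcos
  have h := (memL2_of_continuousOn cg.continuousOn).hasSum_sinCoeff_sq.div_const 2
  simpa [hcoeff, l2norm_sq, mul_pow] using h

theorem two_mul_mul_integral_sq (h0 : g 0 = 1) (h1 : g 1 = 0) :
    2 * s * ∫ x in (0 : ℝ)..1, g x ^ 2 = -g' 1 ^ 2 - g' 0 := by
  have cg : Continuous g := continuous_iff_continuousAt.2 fun x => (hg x).continuousAt
  -- The energy `g' ^ 2 - s * g ^ 2` is constant.
  have hprim (x : ℝ) : HasDerivAt (fun x => g x * g' x - x * (g' x ^ 2 - s * g x ^ 2))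
      (2 * s * g x ^ 2) x := by
    refine (((hg x).mul (hg' x)).sub ((hasDerivAt_id x).mul
      (((hg' x).pow 2).sub (((hg x).pow 2).const_mul s)))).congr_deriv ?_
    simp only [Pi.pow_apply, Pi.sub_apply, one_mul, id_eq, Nat.cast_ofNat, Nat.add_one_sub_one,
      pow_one]
    ring
  rw [← intervalIntegral.integral_const_mul,
    intervalIntegral.integral_eq_sub_of_hasDerivAt (fun x _ => hprim x)
      (Continuous.intervalIntegrable (by fun_prop) _ _), h0, h1]
  ring

theorem hasSum_frequency_div_sq_of_ne_zero (hs : -π ^ 2 < s) (hs0 : s ≠ 0) (h0 : g 0 = 1)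
    (h1 : g 1 = 0) :
    HasSum (fun n => (frequency n / (frequency n ^ 2 + s)) ^ 2)
      ((-g' 1 ^ 2 - g' 0) / (4 * s)) := by
  convert hasSum_frequency_div_sq hg hg' hs h0 h1 using 1
  rw [← two_mul_mul_integral_sq hg hg' h0 h1]
  field_simp
  ring

end Resolvent

theorem gain_nonneg {s : ℝ} (hs : -π ^ 2 < s) : 0 ≤ gain s := by
  unfold gain
  split_ifs with hpos hzero
  · have : 0 ≤ exp √s - exp (-√s) :=
      sub_nonneg.2 (exp_le_exp.2 (by linarith [sqrt_nonneg s]))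
    positivity
  · positivity
  · have : 0 ≤ sin √(-s) := sin_nonneg_of_nonneg_of_le_pi (sqrt_nonneg _)
      ((sqrt_le_left pi_pos.le).2 (by linarith))
    have : 0 ≤ -s := by linarith
    positivity

theorem sq_rpow_one_fourth_sq {ω : ℝ} (hω : 0 ≤ ω) : ((ω ^ 2) ^ (1 / 4 : ℝ)) ^ 2 = ω := by
  rw [← rpow_natCast, ← rpow_natCast, ← rpow_mul hω, ← rpow_mul hω]
  norm_num

theorem gain_sq_of_pos {ω : ℝ} (hω : 0 < ω) :
    gain (ω ^ 2) ^ 2 = (sinh ω * cosh ω - ω) / (4 * ω * sinh ω ^ 2) := by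
  have hnum : exp (2 * ω) - exp (-(2 * ω)) - 4 * ω = 4 * (sinh ω * cosh ω - ω) := by
    linear_combination (-2) * sinh_eq (2 * ω) + 2 * sinh_two_mul ω
  have hden : exp ω - exp (-ω) = 2 * sinh ω := by
    linear_combination (-2) * sinh_eq ω
  have hnonneg : 0 ≤ 4 * (sinh ω * cosh ω - ω) := by
    linarith [sinh_two_mul ω, self_le_sinh_iff.2 (show 0 ≤ 2 * ω by positivity)]
  rw [gain, if_pos (by positivity), sqrt_sq hω.le, hnum, hden, div_pow, mul_pow, mul_pow,
    sq_rpow_one_fourth_sq hω.le, sq_sqrt hnonneg]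
  have : sinh ω ≠ 0 := (sinh_pos_iff.2 hω).ne'
  field_simp
  ring

theorem gain_sq_of_neg {ω : ℝ} (hω : 0 < ω) :
    gain (-ω ^ 2) ^ 2 = (ω - sin ω * cos ω) / (4 * ω * sin ω ^ 2) := by
  have hsq : 0 < ω ^ 2 := by positivity
  have hnonneg : 0 ≤ 4 * ω - 2 * sin (2 * ω) := by
    linarith [sin_le (show 0 ≤ 2 * ω by positivity)]
  rw [gain, if_neg (by linarith), if_neg (by linarith), neg_neg, sqrt_sq hω.le, div_pow,
    mul_pow, mul_pow, sq_rpow_one_fourth_sq hω.le, sq_sqrt hnonneg, sin_two_mul]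
  field_simp
  ring

theorem hasDerivAt_mul_one_sub (ω x : ℝ) : HasDerivAt (fun x : ℝ => ω * (1 - x)) (-ω) x := by
  simpa using ((hasDerivAt_id x).const_sub 1).const_mul ω

theorem hasSum_gain_sq_of_pos {ω : ℝ} (hω : 0 < ω) :
    HasSum (fun n => (frequency n / (frequency n ^ 2 + ω ^ 2)) ^ 2) (gain (ω ^ 2) ^ 2) := by
  have hsinh : sinh ω ≠ 0 := (sinh_pos_iff.2 hω).ne'
  convert hasSum_frequency_div_sq_of_ne_zero (s := ω ^ 2)
    (g := fun x => sinh (ω * (1 - x)) / sinh ω) (g' := fun x => cosh (ω * (1 - x)) * -ω / sinh ω)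
    (fun x => (hasDerivAt_mul_one_sub ω x).sinh.div_const _)
    (fun x => (((hasDerivAt_mul_one_sub ω x).cosh.mul_const _).div_const _).congr_deriv (by ring))
    (by nlinarith [pi_pos]) (by positivity) (by simp [hsinh]) (by simp) using 1
  rw [gain_sq_of_pos hω]
  simp only [sub_self, mul_zero, cosh_zero, mul_neg, one_mul, sub_zero, mul_one]
  field_simp
  ring

theorem hasSum_gain_sq_of_neg {ω : ℝ} (hω : 0 < ω) (hπ : ω < π) :
    HasSum (fun n => (frequency n / (frequency n ^ 2 + -ω ^ 2)) ^ 2) (gain (-ω ^ 2) ^ 2) := by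
  have hsin : sin ω ≠ 0 := (sin_pos_of_pos_of_lt_pi hω hπ).ne'
  convert hasSum_frequency_div_sq_of_ne_zero (s := -ω ^ 2)
    (g := fun x => sin (ω * (1 - x)) / sin ω) (g' := fun x => cos (ω * (1 - x)) * -ω / sin ω)
    (fun x => (hasDerivAt_mul_one_sub ω x).sin.div_const _)
    (fun x => (((hasDerivAt_mul_one_sub ω x).cos.mul_const _).div_const _).congr_deriv (by ring))
    (by nlinarith) (by simp [hω.ne']) (by simp [hsin]) (by simp) using 1
  rw [gain_sq_of_neg hω]
  simp only [sub_self, mul_zero, cos_zero, mul_neg, one_mul, sub_zero, mul_one]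
  field_simp
  ring

theorem hasSum_gain_sq_zero :
    HasSum (fun n => (frequency n / (frequency n ^ 2 + 0)) ^ 2) (gain 0 ^ 2) := by
  convert hasSum_frequency_div_sq (s := 0) (g := fun x => 1 * (1 - x)) (g' := fun _ => -1)
    (hasDerivAt_mul_one_sub 1) (fun x => by simpa using hasDerivAt_const x (-1 : ℝ))
    (by simp [pi_pos]) (by simp) (by simp) using 1
  have hint : ∫ x in (0 : ℝ)..1, (1 * (1 - x)) ^ 2 = 1 / 3 := by
    simp only [one_mul, intervalIntegral.integral_comp_sub_left (fun x => x ^ 2), integral_pow]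
    norm_num
  rw [hint, gain, if_neg (lt_irrefl _), if_pos rfl, div_pow, sq_sqrt (by norm_num)]
  norm_num

theorem hasSum_gain_sq {s : ℝ} (hs : -π ^ 2 < s) :
    HasSum (fun n => (frequency n / (frequency n ^ 2 + s)) ^ 2) (gain s ^ 2) := by
  rcases lt_trichotomy s 0 with hneg | rfl | hpos
  · have hsq : s = -√(-s) ^ 2 := by rw [sq_sqrt (by linarith), neg_neg]
    have hπ : √(-s) < π := (sqrt_lt' pi_pos).2 (by linarith)
    rw [hsq]
    exact hasSum_gain_sq_of_neg (sqrt_pos.2 (by linarith)) hπ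
  · exact hasSum_gain_sq_zero
  · rw [← sq_sqrt hpos.le]
    exact hasSum_gain_sq_of_pos (sqrt_pos.2 hpos)

theorem norm_sub_le_of_norm_deriv_le_off_countable {E : Type*} [NormedAddCommGroup E]
    [NormedSpace ℝ E] [CompleteSpace E] {v v' : ℝ → E} {B B' : ℝ → ℝ} {C : Set ℝ}
    (hC : C.Countable) {a b : ℝ} (hab : a ≤ b) (hv : ContinuousOn v (Icc a b))
    (hv' : ∀ s ∈ Ioo a b \ C, HasDerivAt v (v' s) s) (hB : ∀ s, HasDerivAt B (B' s) s)
    (hB' : Continuous B') (hbound : ∀ s ∈ Ioo a b \ C, ‖v' s‖ ≤ B' s) :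
    ‖v b - v a‖ ≤ B b - B a := by
  have hBint : IntervalIntegrable B' volume a b := hB'.intervalIntegrable _ _
  have hderiv : ∀ᵐ s ∂volume.restrict (Ioc a b), ‖deriv v s‖ ≤ B' s := by
    have hnotMem : ∀ᵐ s ∂volume, s ∉ insert b C :=
      measure_eq_zero_iff_ae_notMem.1 ((hC.insert b).measure_zero _)
    filter_upwards [ae_restrict_of_ae hnotMem, ae_restrict_mem measurableSet_Ioc] with s hs hs'
    rw [mem_insert_iff, not_or] at hs
    have hmem : s ∈ Ioo a b \ C := ⟨⟨hs'.1, hs'.2.lt_of_ne hs.1⟩, hs.2⟩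
    rw [(hv' s hmem).deriv]
    exact hbound s hmem
  have hvint : IntervalIntegrable (deriv v) volume a b := by
    rw [intervalIntegrable_iff_integrableOn_Ioc_of_le hab] at hBint ⊢
    exact hBint.mono' (aestronglyMeasurable_deriv v _) hderiv
  rw [← integral_eq_of_hasDerivAt_off_countable_of_le v (deriv v) hab hC hv
      (fun s hs => (hv' s hs).differentiableAt.hasDerivAt) hvint,
    ← intervalIntegral.integral_eq_sub_of_hasDerivAt (fun s _ => hB s) hBint]
  exact intervalIntegral.norm_integral_le_of_norm_le hab
    ((ae_restrict_iff' measurableSet_Ioc).1 hderiv) hBint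

theorem hasDerivAt_exp_neg_mul_sub (c t s : ℝ) :
    HasDerivAt (fun s => exp (-c * (t - s))) (c * exp (-c * (t - s))) s := by
  simpa [mul_comm] using (((hasDerivAt_id s).const_sub t).const_mul (-c)).exp

theorem hasDerivAt_euclideanSpace {ι : Type*} [Fintype ι] {v : ℝ → EuclideanSpace ℝ ι}
    {v' : EuclideanSpace ℝ ι} {s : ℝ} :
    HasDerivAt v v' s ↔ ∀ i, HasDerivAt (fun s => v s i) (v' i) s := by
  simp only [← hasDerivWithinAt_univ, hasDerivWithinAt_iff_hasFDerivWithinAt,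
    hasFDerivWithinAt_euclidean]
  rfl

theorem norm_sq_toLp_coe {ι : Type*} (I : Finset ι) (z : ι → ℝ) :
    ‖WithLp.toLp 2 (fun i : I => z i)‖ ^ 2 = ∑ i ∈ I, z i ^ 2 :=
  (EuclideanSpace.real_norm_sq_eq _).trans (Finset.sum_coe_sort I fun i => z i ^ 2)

theorem sum_exp_mul_sq_le {ι : Type*} {I : Finset ι} {Λ y : ι → ℝ} {μ r Y : ℝ} (hr : 0 ≤ r)
    (hμ : ∀ i ∈ I, μ ≤ Λ i) (hy : ∑ i ∈ I, y i ^ 2 ≤ Y ^ 2) :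
    ∑ i ∈ I, (exp (-Λ i * r) * y i) ^ 2 ≤ (exp (-μ * r) * Y) ^ 2 :=
  calc ∑ i ∈ I, (exp (-Λ i * r) * y i) ^ 2
      ≤ ∑ i ∈ I, exp (-μ * r) ^ 2 * y i ^ 2 := by
        refine Finset.sum_le_sum fun i hi => ?_
        rw [mul_pow]
        have := hμ i hi
        gcongr
    _ ≤ (exp (-μ * r) * Y) ^ 2 := by
        rw [← Finset.mul_sum, mul_pow]
        exact mul_le_mul_of_nonneg_left hy (by positivity)

/-- Duhamel's principle for the system `xᵢ' = -Λᵢ xᵢ + yᵢ`, in the Euclidean norm. -/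
theorem sum_sub_exp_mul_sq_le {ι : Type*} (I : Finset ι) {Λ : ι → ℝ} {x y : ι → ℝ → ℝ}
    {C : Set ℝ} (hC : C.Countable) {μ σ S t : ℝ} (ht : 0 ≤ t) (hS : 0 ≤ S) (hσ : σ < μ)
    (hμ : ∀ i ∈ I, μ ≤ Λ i) (hx : ∀ i ∈ I, ContinuousOn (x i) (Icc 0 t))
    (hx' : ∀ i ∈ I, ∀ s ∈ Ioo 0 t \ C, HasDerivAt (x i) (-Λ i * x i s + y i s) s)
    (hy : ∀ s ∈ Ioo 0 t \ C, ∑ i ∈ I, y i s ^ 2 ≤ (S * exp (σ * (t - s))) ^ 2) :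
    ∑ i ∈ I, (x i t - exp (-Λ i * t) * x i 0) ^ 2 ≤ (S / (μ - σ)) ^ 2 := by
  let e (z : ι → ℝ → ℝ) (s : ℝ) : EuclideanSpace ℝ I :=
    WithLp.toLp 2 fun i => exp (-Λ i * (t - s)) * z i s
  have hcont : ContinuousOn (e x) (Icc 0 t) :=
    (PiLp.continuous_toLp 2 _).comp_continuousOn <| continuousOn_pi.2 fun i =>
      ContinuousOn.mul (by fun_prop) (hx i i.2)
  have hderiv : ∀ s ∈ Ioo 0 t \ C, HasDerivAt (e x) (e y s) s := fun s hs =>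
    hasDerivAt_euclideanSpace.2 fun i =>
      ((hasDerivAt_exp_neg_mul_sub (Λ i) t s).mul (hx' i i.2 s hs)).congr_deriv (by
        simp only [e]
        ring)
  have hB (s : ℝ) : HasDerivAt (fun s => S / (μ - σ) * exp (-(μ - σ) * (t - s)))
      (S * exp (-(μ - σ) * (t - s))) s :=
    ((hasDerivAt_exp_neg_mul_sub (μ - σ) t s).const_mul _).congr_deriv (by
      field_simp [(sub_pos.2 hσ).ne'])
  have hbound : ∀ s ∈ Ioo 0 t \ C, ‖e y s‖ ≤ S * exp (-(μ - σ) * (t - s)) := by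
    intro s hs
    refine abs_le_of_sq_le_sq' ?_ (by positivity) |>.2
    calc ‖e y s‖ ^ 2
        = ∑ i ∈ I, (exp (-Λ i * (t - s)) * y i s) ^ 2 :=
          norm_sq_toLp_coe I fun i => exp (-Λ i * (t - s)) * y i s
      _ ≤ (exp (-μ * (t - s)) * (S * exp (σ * (t - s)))) ^ 2 :=
          sum_exp_mul_sq_le (sub_nonneg.2 hs.1.2.le) hμ (hy s hs)
      _ = (S * exp (-(μ - σ) * (t - s))) ^ 2 := by
          rw [mul_left_comm, ← exp_add]
          ring_nf
  have hle := norm_sub_le_of_norm_deriv_le_off_countable hC ht hcont hderiv hB (by fun_prop) hbound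
  have hBpos : 0 ≤ S / (μ - σ) * exp (-(μ - σ) * (t - 0)) := by
    have := sub_pos.2 hσ
    positivity
  calc ∑ i ∈ I, (x i t - exp (-Λ i * t) * x i 0) ^ 2
      = ‖e x t - e x 0‖ ^ 2 := by
        rw [← norm_sq_toLp_coe]
        congr 2
        ext i
        simp [e]
    _ ≤ (S / (μ - σ)) ^ 2 := by
        refine pow_le_pow_left₀ (norm_nonneg _) (hle.trans ?_) 2
        rw [sub_self, mul_zero, exp_zero, mul_one]
        linarith

theorem sum_add_sq_le {ι : Type*} {I : Finset ι} {x y : ι → ℝ} {X Y : ℝ} (hX : 0 ≤ X)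
    (hY : 0 ≤ Y) (hx : ∑ i ∈ I, x i ^ 2 ≤ X ^ 2) (hy : ∑ i ∈ I, y i ^ 2 ≤ Y ^ 2) :
    ∑ i ∈ I, (x i + y i) ^ 2 ≤ (X + Y) ^ 2 := by
  have hxy : ∑ i ∈ I, x i * y i ≤ X * Y := abs_le_of_sq_le_sq' (by
    calc (∑ i ∈ I, x i * y i) ^ 2 ≤ (∑ i ∈ I, x i ^ 2) * ∑ i ∈ I, y i ^ 2 :=
          Finset.sum_mul_sq_le_sq_mul_sq I x y
      _ ≤ X ^ 2 * Y ^ 2 := by gcongr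
      _ = (X * Y) ^ 2 := (mul_pow X Y 2).symm) (mul_nonneg hX hY) |>.2
  calc ∑ i ∈ I, (x i + y i) ^ 2
      = ∑ i ∈ I, x i ^ 2 + 2 * ∑ i ∈ I, x i * y i + ∑ i ∈ I, y i ^ 2 := by
        simp only [add_sq, Finset.sum_add_distrib, Finset.mul_sum, mul_assoc]
    _ ≤ X ^ 2 + 2 * (X * Y) + Y ^ 2 := by gcongr
    _ = (X + Y) ^ 2 := by ring

theorem le_mul_add_of_hasSum_sq {ι : Type*} {x a κ : ι → ℝ} {X A B k : ℝ}
    (hx : HasSum (fun i => x i ^ 2) (X ^ 2)) (ha : HasSum (fun i => a i ^ 2) (A ^ 2)) (hA : 0 ≤ A)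
    (hB : 0 ≤ B) (hk : 0 ≤ k) (hκ : ∀ i, |κ i| ≤ k)
    (hsub : ∀ I : Finset ι, ∑ i ∈ I, (x i - κ i * a i) ^ 2 ≤ B ^ 2) : X ≤ k * A + B := by
  refine abs_le_of_sq_le_sq' (hasSum_le_of_sum_le hx fun I => ?_) (by positivity) |>.2
  have hκa : ∑ i ∈ I, (κ i * a i) ^ 2 ≤ (k * A) ^ 2 :=
    calc ∑ i ∈ I, (κ i * a i) ^ 2 ≤ ∑ i ∈ I, k ^ 2 * a i ^ 2 := by
          refine Finset.sum_le_sum fun i _ => ?_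
          rw [mul_pow]
          exact mul_le_mul_of_nonneg_right (sq_le_sq' (neg_le_of_abs_le (hκ i))
            (le_of_abs_le (hκ i))) (sq_nonneg _)
      _ = k ^ 2 * ∑ i ∈ I, a i ^ 2 := (Finset.mul_sum _ _ _).symm
      _ ≤ k ^ 2 * A ^ 2 := by
          gcongr
          exact sum_le_hasSum I (fun i _ => sq_nonneg _) ha
      _ = (k * A) ^ 2 := (mul_pow k A 2).symm
  simpa using sum_add_sq_le (mul_nonneg hk hA) hB hκa (hsub I)

theorem hasDerivAt_integral_of_continuousOn_deriv {E : Type*} [NormedAddCommGroup E]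
    [NormedSpace ℝ E] {U : Set ℝ} (hU : IsOpen U) {a b : ℝ} (hab : a ≤ b) {F F' : ℝ → ℝ → E}
    (hF : ∀ s ∈ U, ContinuousOn (F s) (Icc a b))
    (hderiv : ∀ s ∈ U, ∀ x ∈ Icc a b, HasDerivAt (fun s => F s x) (F' s x) s)
    (hF' : ContinuousOn (fun z : ℝ × ℝ => F' z.1 z.2) (U ×ˢ Icc a b)) {t : ℝ} (ht : t ∈ U) :
    HasDerivAt (fun s => ∫ x in a..b, F s x) (∫ x in a..b, F' t x) t := by
  have hIoc : uIoc a b ⊆ Icc a b := uIoc_of_le hab ▸ Ioc_subset_Icc_self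
  obtain ⟨ε, hε, hball⟩ := Metric.nhds_basis_closedBall.mem_iff.1 (hU.mem_nhds ht)
  obtain ⟨M, hM⟩ := ((isCompact_closedBall t ε).prod isCompact_Icc).exists_bound_of_continuousOn
    (hF'.mono (prod_mono_left hball))
  have hslice : ContinuousOn (F' t) (Icc a b) :=
    hF'.comp (f := fun x => (t, x)) (by fun_prop) fun x hx => ⟨ht, hx⟩
  refine (intervalIntegral.hasDerivAt_integral_of_dominated_loc_of_deriv_le
    (bound := fun _ => M) (Metric.closedBall_mem_nhds t hε) ?_
    ((hF t ht).mono (uIcc_of_le hab).subset).intervalIntegrable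
    ((hslice.mono hIoc).aestronglyMeasurable measurableSet_uIoc)
    (Eventually.of_forall fun x hx s hs => hM (s, x) ⟨hs, hIoc hx⟩) intervalIntegrable_const
    (Eventually.of_forall fun x hx s hs => hderiv s (hball hs) x (hIoc hx))).2
  filter_upwards [hU.mem_nhds ht] with s hs
  exact ((hF s hs).mono hIoc).aestronglyMeasurable measurableSet_uIoc

section TimeDerivative

variable {E : Type*} [NormedAddCommGroup E] [NormedSpace ℝ E] {U : Set ℝ} (hU : IsOpen U)
  {a b : ℝ} {F : ℝ → ℝ → E} (hF : ContDiffOn ℝ 1 (fun z : ℝ × ℝ => F z.1 z.2) (U ×ˢ Icc a b))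
include hU hF

theorem hasDerivAt_fst_of_contDiffOn {s x : ℝ} (hs : s ∈ U) (hx : x ∈ Icc a b) :
    HasDerivAt (fun s => F s x)
      (fderivWithin ℝ (fun z : ℝ × ℝ => F z.1 z.2) (U ×ˢ Icc a b) (s, x) (1, 0)) s := by
  have hline : HasDerivWithinAt (fun s => (s, x)) ((1 : ℝ), (0 : ℝ)) U s :=
    ((hasDerivAt_id s).prodMk (hasDerivAt_const s x)).hasDerivWithinAt
  have hfderiv := (hF.differentiableOn one_ne_zero (s, x) ⟨hs, hx⟩).hasFDerivWithinAt
  exact (hfderiv.comp_hasDerivWithinAt s hline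
    fun _ hs' => mk_mem_prod hs' hx).hasDerivAt (hU.mem_nhds hs)

theorem continuousOn_deriv_fst_of_contDiffOn (hab : a < b) :
    ContinuousOn (fun z : ℝ × ℝ => deriv (fun s => F s z.2) z.1) (U ×ˢ Icc a b) :=
  ((hF.continuousOn_fderivWithin (hU.uniqueDiffOn.prod (uniqueDiffOn_Icc hab)) le_rfl).clm_apply
    continuousOn_const).congr fun _ hz => (hasDerivAt_fst_of_contDiffOn hU hF hz.1 hz.2).deriv

end TimeDerivative

theorem hasDerivAt_sinCoeff {U : Set ℝ} (hU : IsOpen U) {u : ℝ → ℝ → ℝ}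
    (hu : ContDiffOn ℝ 1 (fun z : ℝ × ℝ => u z.1 z.2) (U ×ˢ Icc 0 1)) {t : ℝ} (ht : t ∈ U)
    (n : ℕ) :
    HasDerivAt (fun s => sinCoeff (u s) n) (sinCoeff (fun x => deriv (fun s => u s x) t) n) t := by
  refine (hasDerivAt_integral_of_continuousOn_deriv hU zero_le_one
    (F := fun s x => u s x * sin (frequency n * x))
    (F' := fun s x => deriv (fun s => u s x) s * sin (frequency n * x))
    (fun s hs => ?_) (fun s hs x hx => ?_) ?_ ht).const_mul √2
  · exact (hu.continuousOn.comp (f := fun x => (s, x)) (by fun_prop) fun x hx => ⟨hs, hx⟩).mul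
      (by fun_prop)
  · exact (hasDerivAt_fst_of_contDiffOn hU hu hs hx).differentiableAt.hasDerivAt.mul_const _
  · exact (continuousOn_deriv_fst_of_contDiffOn hU hu one_pos).mul (by fun_prop)

namespace IsTimeSeq

variable {τ : ℕ → ℝ} (hτ : IsTimeSeq τ)
include hτ

theorem pos_of_mem_regularTimes {t : ℝ} (ht : t ∈ regularTimes τ) : 0 < t :=
  lt_of_le_of_ne ht.1 fun h0 => ht.2 ⟨0, hτ.2.1.trans h0⟩

theorem isClosed_range : IsClosed (range τ) := by
  have hτ' : Tendsto τ (cocompact ℕ) (cocompact ℝ) := by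
    rw [cocompact_eq_cofinite, Nat.cofinite_eq_atTop]
    exact hτ.2.2.mono_right atTop_le_cocompact
  exact (isProperMap_iff_tendsto_cocompact.2
    ⟨continuous_of_discreteTopology, hτ'⟩).isClosedMap.isClosed_range

theorem isOpen_regularTimes : IsOpen (regularTimes τ) := by
  have heq : regularTimes τ = Ioi 0 \ range τ := by
    ext t
    exact ⟨fun ht => ⟨hτ.pos_of_mem_regularTimes ht, ht.2⟩,
      fun ht => ⟨Ioi_subset_Ici_self ht.1, ht.2⟩⟩
  rw [heq]
  exact isOpen_Ioi.sdiff hτ.isClosed_range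

theorem Ioo_subset_regularTimes (i : ℕ) : Ioo (τ i) (τ (i + 1)) ⊆ regularTimes τ := by
  intro t ht
  refine ⟨(hτ.2.1 ▸ hτ.1.monotone i.zero_le : 0 ≤ τ i).trans ht.1.le, ?_⟩
  rintro ⟨j, rfl⟩
  have h1 := hτ.1.lt_iff_lt.1 ht.1
  have h2 := hτ.1.lt_iff_lt.1 ht.2
  omega

theorem bddAbove_image_Ioo {φ : ℝ → ℝ} (hφ : ∀ i, BddAbove (φ '' Ioo (τ i) (τ (i + 1)))) (t : ℝ) :
    BddAbove (φ '' Ioo 0 t) := by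
  have hprefix (k : ℕ) : BddAbove (φ '' Ioo 0 (τ k)) := by
    induction k with
    | zero => simp [hτ.2.1]
    | succ k ih =>
      have hsub : Ioo 0 (τ (k + 1)) ⊆ Ioo 0 (τ k) ∪ {τ k} ∪ Ioo (τ k) (τ (k + 1)) := by
        intro s hs
        rcases lt_trichotomy s (τ k) with h | h | h
        · exact Or.inl (Or.inl ⟨hs.1, h⟩)
        · exact Or.inl (Or.inr h)
        · exact Or.inr ⟨h, hs.2⟩
      refine BddAbove.mono (image_mono hsub) ?_
      rw [image_union, image_union, image_singleton]
      exact (ih.union bddAbove_singleton).union (hφ k)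
  obtain ⟨k, hk⟩ := (hτ.2.2.eventually_ge_atTop t).exists
  exact (hprefix k).mono (image_mono (Ioo_subset_Ioo_right hk))

end IsTimeSeq

theorem SLOperator.continuousOn_apply (A : SLOperator) {g : ℝ → ℝ}
    (hg : ContDiffOn ℝ 2 g (Icc 0 1)) : ContinuousOn (A.apply g) (Icc 0 1) := by
  have hI : UniqueDiffOn ℝ (Icc (0 : ℝ) 1) := uniqueDiffOn_Icc one_pos
  have hr : ∀ x ∈ Icc (0 : ℝ) 1, A.r x ≠ 0 := fun x hx => (A.r_pos x hx).ne'
  have hflux : ContDiffOn ℝ 1 (fun x => A.p x * derivWithin g (Icc 0 1) x) (Icc 0 1) :=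
    A.p_smooth.mul (hg.derivWithin hI (by norm_num))
  exact ((continuousOn_const.div A.r_cont hr).neg.mul
    (hflux.continuousOn_derivWithin hI le_rfl)).add
      ((A.q_cont.div A.r_cont hr).mul hg.continuousOn)

/-- The eigenvalues `p(nπ)² + q`, `n ≥ 1`, of `dirichletOp p q`, indexed from `0`. -/
noncomputable def eigenvalue (p q : ℝ) (n : ℕ) : ℝ :=
  p * frequency n ^ 2 + q

section DirichletOp

variable {p q : ℝ} (hp : 0 < p)
include hp

theorem le_eigenvalue (n : ℕ) : p * π ^ 2 + q ≤ eigenvalue p q n :=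
  add_le_add_left (mul_le_mul_of_nonneg_left (pi_sq_le_frequency_sq n) hp.le) q

theorem abs_exp_neg_eigenvalue_mul_le {t : ℝ} (ht : 0 ≤ t) (n : ℕ) :
    |exp (-eigenvalue p q n * t)| ≤ exp (-(p * π ^ 2 + q) * t) := by
  rw [abs_exp]
  have := le_eigenvalue (q := q) hp n
  gcongr

theorem frequency_div_eigenvalue_sub_le {σ : ℝ} (hσ0 : 0 ≤ σ) (hσ : σ < p * π ^ 2 + q) (n : ℕ) :
    frequency n / (eigenvalue p q n - σ) ≤
      (p * π ^ 2 + q) / (p * π ^ 2 + q - σ) * p⁻¹ * (frequency n / (frequency n ^ 2 + q / p)) := by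
  have hle := le_eigenvalue (q := q) hp n
  have hgap : 0 < p * π ^ 2 + q - σ := sub_pos.2 hσ
  have hpos : 0 < eigenvalue p q n := by linarith
  have heq : frequency n ^ 2 + q / p = eigenvalue p q n / p := by
    rw [eigenvalue]
    field_simp
  calc frequency n / (eigenvalue p q n - σ)
      ≤ frequency n * (p * π ^ 2 + q) / ((p * π ^ 2 + q - σ) * eigenvalue p q n) := by
        rw [div_le_div_iff₀ (by linarith) (by positivity), mul_assoc]
        refine mul_le_mul_of_nonneg_left ?_ (frequency_pos n).le
        linarith [mul_le_mul_of_nonneg_left hle hσ0]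
    _ = _ := by
        rw [heq]
        field_simp

theorem dirichletOp_apply {g : ℝ → ℝ} (hg : ContDiffOn ℝ 2 g (Icc 0 1)) {x : ℝ}
    (hx : x ∈ Icc (0 : ℝ) 1) :
    (dirichletOp p q hp).apply g x =
      -p * derivWithin (derivWithin g (Icc 0 1)) (Icc 0 1) x + q * g x := by
  have hI : UniqueDiffOn ℝ (Icc (0 : ℝ) 1) := uniqueDiffOn_Icc one_pos
  have hg' : DifferentiableWithinAt ℝ (derivWithin g (Icc 0 1)) (Icc 0 1) x :=
    (hg.derivWithin (m := 1) hI (by norm_num)).differentiableOn one_ne_zero x hx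
  simp only [SLOperator.apply, dirichletOp]
  rw [(hg'.hasDerivWithinAt.const_mul p).derivWithin (hI x hx)]
  ring

theorem sinCoeff_dirichletOp_apply {g : ℝ → ℝ} (hg : ContDiffOn ℝ 2 g (Icc 0 1)) (h0 : g 0 = 0)
    (h1 : g 1 = 0) (n : ℕ) :
    sinCoeff ((dirichletOp p q hp).apply g) n = eigenvalue p q n * sinCoeff g n := by
  have hI : UniqueDiffOn ℝ (Icc (0 : ℝ) 1) := uniqueDiffOn_Icc one_pos
  have hg'' : MemL2 (derivWithin (derivWithin g (Icc 0 1)) (Icc 0 1)) := memL2_of_continuousOn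
    ((hg.derivWithin (m := 1) hI (by norm_num)).continuousOn_derivWithin hI le_rfl)
  rw [sinCoeff_congr fun x hx => dirichletOp_apply hp hg (Ioo_subset_Icc_self hx),
    sinCoeff_add (hg''.const_mul _) ((memL2_of_continuousOn hg.continuousOn).const_mul _),
    sinCoeff_const_mul, sinCoeff_const_mul, sinCoeff_derivWithin_derivWithin hg h0 h1, eigenvalue]
  ring

theorem weightedNorm_dirichletOp (g : ℝ → ℝ) :
    weightedNorm (dirichletOp p q hp).r g = l2norm g := by
  simp only [weightedNorm, l2norm, dirichletOp, one_mul]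

end DirichletOp

theorem IsGDOn.bddAbove_weightedNorm {A : SLOperator} {s T : ℝ} {f f₁ f₂ : ℝ → ℝ → ℝ}
    {a b c : ℝ → ℝ} (h : IsGDOn A s T f f₁ f₂ a b c) :
    BddAbove ((fun t => weightedNorm A.r (f t)) '' Ioo s T) := by
  obtain ⟨M, hM⟩ := h.bound
  refine ⟨√(2 * M), forall_mem_image.2 fun t ht => sqrt_le_sqrt ?_⟩
  have hI : uIcc (0 : ℝ) 1 = Icc 0 1 := uIcc_of_le zero_le_one
  have hr : ContinuousOn A.r (uIcc 0 1) := hI ▸ A.r_cont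
  have hf₁ : ContinuousOn (f₁ t) (uIcc 0 1) := hI ▸ (h.f₁_pc1 t ht).continuousOn
  have hf₂ : ContinuousOn (f₂ t) (uIcc 0 1) := hI ▸ (h.f₂_dom t ht).1.continuousOn
  have hAf₂ : ContinuousOn (A.apply (f₂ t)) (uIcc 0 1) :=
    hI ▸ A.continuousOn_apply (h.f₂_dom t ht).1
  have hf : ContinuousOn (f t) (uIcc 0 1) := (hf₁.add hf₂).congr fun x hx =>
    h.sum_eq t ht x (hI ▸ hx)
  calc ∫ x in (0 : ℝ)..1, A.r x * |f t x| ^ 2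
      ≤ ∫ x in (0 : ℝ)..1,
          2 * (A.r x * (|f₁ t x| ^ 2 + |f₂ t x| ^ 2 + |A.apply (f₂ t) x| ^ 2)) := by
        refine intervalIntegral.integral_mono_on zero_le_one
          (hr.mul (hf.abs.pow 2)).intervalIntegrable
          (continuousOn_const.mul (hr.mul
            (((hf₁.abs.pow 2).add (hf₂.abs.pow 2)).add (hAf₂.abs.pow 2)))).intervalIntegrable
          fun x hx => ?_
        rw [h.sum_eq t ht x hx, mul_left_comm]
        refine mul_le_mul_of_nonneg_left ?_ (A.r_pos x hx).le
        simp only [sq_abs]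
        linarith [add_sq_le (a := f₁ t x) (b := f₂ t x), sq_nonneg (A.apply (f₂ t) x)]
    _ ≤ 2 * M := by
        rw [intervalIntegral.integral_const_mul]
        exact mul_le_mul_of_nonneg_left (hM t ht) zero_le_two

theorem IsGDWith.bddAbove_weightedNorm {A : SLOperator} {τ : ℕ → ℝ} {f : ℝ → ℝ → ℝ}
    (hf : IsGDWith A τ f) (t : ℝ) :
    BddAbove ((fun s => weightedNorm A.r (f s)) '' Ioo 0 t) :=
  hf.1.bddAbove_image_Ioo (fun i => by
    obtain ⟨f₁, f₂, a, b, c, h⟩ := hf.2 i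
    exact h.bddAbove_weightedNorm) t

theorem bddAbove_fadingValues {f : ℝ → ℝ → ℝ} {t : ℝ}
    (hf : BddAbove ((fun s => l2norm (f s)) '' Ioo 0 t)) (σ : ℝ) :
    BddAbove (fadingValues f σ t) := by
  obtain ⟨M, hM⟩ := hf
  have hexp : ContinuousOn (fun s => exp (-σ * (t - s))) (Icc 0 t) := by fun_prop
  obtain ⟨K, hK⟩ := (isCompact_Icc.image_of_continuousOn hexp).bddAbove
  refine ⟨M * K, forall_mem_image.2 fun s hs => ?_⟩
  have hM' : l2norm (f s) ≤ M := hM (mem_image_of_mem _ hs)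
  exact mul_le_mul hM' (hK (mem_image_of_mem _ (Ioo_subset_Icc_self hs))) (exp_pos _).le
    ((l2norm_nonneg _).trans hM')

theorem IsGDWith.bddAbove_fadingValues {p q : ℝ} {hp : 0 < p} {τ : ℕ → ℝ} {f : ℝ → ℝ → ℝ}
    (hf : IsGDWith (dirichletOp p q hp) τ f) (σ t : ℝ) : BddAbove (fadingValues f σ t) :=
  ParabolicSL.bddAbove_fadingValues
    (by simpa only [weightedNorm_dirichletOp] using hf.bddAbove_weightedNorm t) σ

namespace IsSolution

section SLOperator

variable {A : SLOperator} {τ : ℕ → ℝ} {f : ℝ → ℝ → ℝ} {d₀ d₁ u₀ : ℝ → ℝ} {u : ℝ → ℝ → ℝ}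
  (hτ : IsTimeSeq τ) (hu : IsSolution A τ f d₀ d₁ u₀ u)
include hτ hu

theorem memL2_deriv_fst {t : ℝ} (ht : t ∈ regularTimes τ) :
    MemL2 (fun x => deriv (fun s => u s x) t) :=
  memL2_of_continuousOn
    ((continuousOn_deriv_fst_of_contDiffOn hτ.isOpen_regularTimes hu.contDiff one_pos).comp
      (f := fun x => (t, x)) (by fun_prop) fun _ hx => ⟨ht, hx⟩)

theorem memL2_apply {t : ℝ} (ht : t ∈ regularTimes τ) : MemL2 (A.apply (u t)) :=
  memL2_of_continuousOn (A.continuousOn_apply (hu.profile t (hτ.pos_of_mem_regularTimes ht)))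

theorem memL2_input {t : ℝ} (ht : t ∈ regularTimes τ) : MemL2 (f t) :=
  MemL2.congr ((hu.memL2_deriv_fst hτ ht).add (hu.memL2_apply hτ ht)) (hu.pde t ht)

theorem sinCoeff_input {t : ℝ} (ht : t ∈ regularTimes τ) (n : ℕ) :
    sinCoeff (f t) n =
      sinCoeff (fun x => deriv (fun s => u s x) t) n + sinCoeff (A.apply (u t)) n := by
  rw [← sinCoeff_add (hu.memL2_deriv_fst hτ ht) (hu.memL2_apply hτ ht)]
  exact (sinCoeff_congr (hu.pde t ht) n).symm

end SLOperator

section DirichletOp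

variable {p q : ℝ} {hp : 0 < p} {τ : ℕ → ℝ} {f : ℝ → ℝ → ℝ} {u₀ : ℝ → ℝ} {u : ℝ → ℝ → ℝ}
  (hu : IsSolution (dirichletOp p q hp) τ f (fun _ => 0) (fun _ => 0) u₀ u)
include hu

theorem eq_zero_of_mem_regularTimes {t : ℝ} (ht : t ∈ regularTimes τ) :
    u t 0 = 0 ∧ u t 1 = 0 := by
  simpa [SLOperator.bdry0, SLOperator.bdry1, dirichletOp] using And.intro (hu.bc0 t ht)
    (hu.bc1 t ht)

theorem eq_zero_of_pos (hτ : IsTimeSeq τ) {t : ℝ} (ht : 0 < t) : u t 0 = 0 ∧ u t 1 = 0 := by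
  by_cases hmem : t ∈ range τ
  · obtain ⟨i, rfl⟩ := hmem
    obtain ⟨j, rfl⟩ : ∃ j, i = j + 1 := Nat.exists_eq_succ_of_ne_zero fun h => by
      rw [h, hτ.2.1] at ht
      exact lt_irrefl _ ht
    have hleft : ∀ᶠ s in 𝓝[<] τ (j + 1), u s 0 = 0 ∧ u s 1 = 0 := by
      filter_upwards [Ioo_mem_nhdsLT (hτ.1 j.lt_succ_self)] with s hs
      exact hu.eq_zero_of_mem_regularTimes (hτ.Ioo_subset_regularTimes j hs)
    exact ⟨tendsto_nhds_unique_of_eventuallyEq (hu.lim_u (j + 1) j.succ_pos 0 (by simp))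
        tendsto_const_nhds (hleft.mono fun _ h => h.1),
      tendsto_nhds_unique_of_eventuallyEq (hu.lim_u (j + 1) j.succ_pos 1 (by simp))
        tendsto_const_nhds (hleft.mono fun _ h => h.2)⟩
  · exact hu.eq_zero_of_mem_regularTimes ⟨ht.le, hmem⟩

theorem continuousOn_sinCoeff (n : ℕ) : ContinuousOn (fun s => sinCoeff (u s) n) (Ici 0) := by
  intro t ht
  rw [ContinuousWithinAt, tendsto_iff_dist_tendsto_zero]
  refine squeeze_zero' (Eventually.of_forall fun _ => dist_nonneg) ?_ (hu.contL2 t ht)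
  filter_upwards [self_mem_nhdsWithin] with s hs
  rw [weightedNorm_dirichletOp, dist_eq, ← sinCoeff_sub (hu.memL2 s hs) (hu.memL2 t ht)]
  exact MemL2.abs_sinCoeff_le ((hu.memL2 s hs).sub (hu.memL2 t ht)) n

theorem hasDerivAt_sinCoeff (hτ : IsTimeSeq τ) {t : ℝ} (ht : t ∈ regularTimes τ) (n : ℕ) :
    HasDerivAt (fun s => sinCoeff (u s) n)
      (-eigenvalue p q n * sinCoeff (u t) n + sinCoeff (f t) n) t := by
  have hpos := hτ.pos_of_mem_regularTimes ht
  obtain ⟨h0, h1⟩ := hu.eq_zero_of_pos hτ hpos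
  convert ParabolicSL.hasDerivAt_sinCoeff hτ.isOpen_regularTimes hu.contDiff ht n using 1
  rw [hu.sinCoeff_input hτ ht, sinCoeff_dirichletOp_apply hp (hu.profile t hpos) h0 h1]
  ring

theorem sinCoeff_zero (n : ℕ) : sinCoeff (u 0) n = sinCoeff u₀ n :=
  sinCoeff_congr (fun x hx => hu.init x (Ioo_subset_Icc_self hx)) n

section Estimates

variable (hτ : IsTimeSeq τ) {S σ t : ℝ} (ht : 0 < t) (hS : 0 ≤ S)
  (hf : ∀ s ∈ Ioo 0 t, l2norm (f s) ≤ S * exp (σ * (t - s)))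
include hτ ht hS hf

theorem sum_sinCoeff_sub_sq_le (I : Finset ℕ) {μ : ℝ} (hσ : σ < μ)
    (hμ : ∀ n ∈ I, μ ≤ eigenvalue p q n) :
    ∑ n ∈ I, (sinCoeff (u t) n - exp (-eigenvalue p q n * t) * sinCoeff u₀ n) ^ 2 ≤
      (S / (μ - σ)) ^ 2 := by
  simp only [← hu.sinCoeff_zero]
  refine sum_sub_exp_mul_sq_le I (x := fun n s => sinCoeff (u s) n)
    (y := fun n s => sinCoeff (f s) n) (countable_range τ) ht.le hS hσ hμ
    (fun n _ => (hu.continuousOn_sinCoeff n).mono Icc_subset_Ici_self)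
    (fun n _ s hs => hu.hasDerivAt_sinCoeff hτ ⟨hs.1.1.le, hs.2⟩ n) fun s hs => ?_
  calc ∑ n ∈ I, sinCoeff (f s) n ^ 2 ≤ l2norm (f s) ^ 2 :=
        sum_le_hasSum I (fun _ _ => sq_nonneg _)
          (hu.memL2_input hτ ⟨hs.1.1.le, hs.2⟩).hasSum_sinCoeff_sq
    _ ≤ (S * exp (σ * (t - s))) ^ 2 := pow_le_pow_left₀ (l2norm_nonneg _) (hf s hs.1) 2

theorem l2norm_le (hσ : σ < p * π ^ 2 + q) :
    l2norm (u t) ≤ exp (-(p * π ^ 2 + q) * t) * l2norm u₀ + S / (p * π ^ 2 + q - σ) := by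
  have hu₀ : MemL2 u₀ :=
    (hu.memL2 0 le_rfl).congr fun x hx => hu.init x (Ioo_subset_Icc_self hx)
  exact le_mul_add_of_hasSum_sq (hu.memL2 t ht.le).hasSum_sinCoeff_sq hu₀.hasSum_sinCoeff_sq
    (l2norm_nonneg _) (div_nonneg hS (sub_nonneg.2 hσ.le)) (exp_pos _).le
    (abs_exp_neg_eigenvalue_mul_le hp ht.le)
    fun I => hu.sum_sinCoeff_sub_sq_le hτ ht hS hf I hσ fun n _ => le_eigenvalue hp n

theorem sq_frequency_mul_sinCoeff_sub_le (hσ0 : 0 ≤ σ) (hσ : σ < p * π ^ 2 + q) (n : ℕ) :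
    (frequency n * sinCoeff (u t) n -
        exp (-eigenvalue p q n * t) * (frequency n * sinCoeff u₀ n)) ^ 2 ≤
      ((p * π ^ 2 + q) / (p * π ^ 2 + q - σ) * p⁻¹ * S) ^ 2 *
        (frequency n / (frequency n ^ 2 + q / p)) ^ 2 := by
  have hσn : σ < eigenvalue p q n := hσ.trans_le (le_eigenvalue hp n)
  have hmode := hu.sum_sinCoeff_sub_sq_le hτ ht hS hf {n} hσn (by simp)
  rw [Finset.sum_singleton] at hmode
  have hratio := frequency_div_eigenvalue_sub_le hp hσ0 hσ n
  have hratio_nonneg : 0 ≤ frequency n / (eigenvalue p q n - σ) :=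
    div_nonneg (frequency_pos n).le (sub_pos.2 hσn).le
  calc (frequency n * sinCoeff (u t) n -
        exp (-eigenvalue p q n * t) * (frequency n * sinCoeff u₀ n)) ^ 2
      = frequency n ^ 2 *
          (sinCoeff (u t) n - exp (-eigenvalue p q n * t) * sinCoeff u₀ n) ^ 2 := by ring
    _ ≤ frequency n ^ 2 * (S / (eigenvalue p q n - σ)) ^ 2 := by gcongr
    _ = (S * (frequency n / (eigenvalue p q n - σ))) ^ 2 := by ring
    _ ≤ (S * ((p * π ^ 2 + q) / (p * π ^ 2 + q - σ) * p⁻¹ *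
          (frequency n / (frequency n ^ 2 + q / p)))) ^ 2 := by gcongr
    _ = _ := by ring

theorem l2norm_spatialDeriv_le (hu₀ : MemH1 u₀) (h0 : u₀ 0 = 0) (h1 : u₀ 1 = 0) (hσ0 : 0 ≤ σ)
    (hσ : σ < p * π ^ 2 + q) :
    l2norm (spatialDeriv u t) ≤ exp (-(p * π ^ 2 + q) * t) * l2norm (deriv u₀) +
      (p * π ^ 2 + q) / (p * π ^ 2 + q - σ) * p⁻¹ * gain (q / p) * S := by
  have hut : MemH1 (u t) := memH1_of_contDiffOn ((hu.profile t ht).of_le one_le_two)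
  obtain ⟨hut0, hut1⟩ := hu.eq_zero_of_pos hτ ht
  have hqp : -π ^ 2 < q / p := by
    rw [lt_div_iff₀ hp]
    linarith
  have hK : 0 ≤ (p * π ^ 2 + q) / (p * π ^ 2 + q - σ) * p⁻¹ * S :=
    mul_nonneg (mul_nonneg (div_nonneg (by linarith) (by linarith)) (inv_pos.2 hp).le) hS
  have hderiv : l2norm (spatialDeriv u t) = l2norm (deriv (u t)) :=
    l2norm_congr (eqOn_derivWithin_Icc (u t) 0 1)
  rw [hderiv, mul_right_comm _ (gain _)]
  refine le_mul_add_of_hasSum_sq (hut.hasSum_frequency_mul_sinCoeff_sq hut0 hut1)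
    (hu₀.hasSum_frequency_mul_sinCoeff_sq h0 h1) (l2norm_nonneg _)
    (mul_nonneg hK (gain_nonneg hqp)) (exp_pos _).le
    (abs_exp_neg_eigenvalue_mul_le hp ht.le) fun I => ?_
  rw [mul_pow]
  exact (Finset.sum_le_sum fun n _ =>
    hu.sq_frequency_mul_sinCoeff_sub_le hτ ht hS hf hσ0 hσ n).trans
      (sum_le_hasSum I (fun _ _ => by positivity) ((hasSum_gain_sq hqp).mul_left _))

end Estimates

end DirichletOp

end IsSolution

section FadingValues

variable {f : ℝ → ℝ → ℝ} {σ t : ℝ}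

theorem sSup_fadingValues_nonneg : 0 ≤ sSup (fadingValues f σ t) :=
  Real.sSup_nonneg <| forall_mem_image.2 fun s _ => mul_nonneg (l2norm_nonneg (f s)) (exp_pos _).le

theorem l2norm_le_sSup_fadingValues_mul_exp (h : BddAbove (fadingValues f σ t)) {s : ℝ}
    (hs : s ∈ Ioo 0 t) : l2norm (f s) ≤ sSup (fadingValues f σ t) * exp (σ * (t - s)) := by
  have hle := le_csSup h (mem_image_of_mem _ hs)
  rwa [neg_mul, exp_neg, ← div_eq_mul_inv, div_le_iff₀ (exp_pos _)] at hle

end FadingValues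

end ParabolicSL

open ParabolicSL in
theorem theorem2p7_general (p q : ℝ) (hp : 0 < p)
    (u₀ : ℝ → ℝ) (hu₀ : MemH1 u₀) (hu₀0 : u₀ 0 = 0) (hu₀1 : u₀ 1 = 0)
    (τ : ℕ → ℝ) (hτ : IsTimeSeq τ) (f : ℝ → ℝ → ℝ) (u : ℝ → ℝ → ℝ)
    (hu : IsSolution (dirichletOp p q hp) τ f (fun _ => 0) (fun _ => 0) u₀ u)
    (σ : ℝ) (hσ : σ ∈ Set.Ico 0 (p * Real.pi ^ 2 + q)) (t : ℝ) (ht : 0 < t)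
    (hf : BddAbove (fadingValues f σ t)) :
    l2norm (u t) ≤ Real.exp (-(p * Real.pi ^ 2 + q) * t) * l2norm u₀
      + 1 / (p * Real.pi ^ 2 + q - σ) * sSup (fadingValues f σ t) ∧
    l2norm (spatialDeriv u t) ≤ Real.exp (-(p * Real.pi ^ 2 + q) * t) * l2norm (deriv u₀)
      + (p * Real.pi ^ 2 + q) / (p * Real.pi ^ 2 + q - σ) * p⁻¹ * gain (q / p)
        * sSup (fadingValues f σ t) := by
  have hS := sSup_fadingValues_nonneg (f := f) (σ := σ) (t := t)
  have hfS : ∀ s ∈ Ioo 0 t, l2norm (f s) ≤ sSup (fadingValues f σ t) * Real.exp (σ * (t - s)) :=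
    fun _ => l2norm_le_sSup_fadingValues_mul_exp hf
  constructor
  · rw [one_div_mul_eq_div]
    exact hu.l2norm_le hτ ht hS hfS hσ.2
  · exact hu.l2norm_spatialDeriv_le hτ ht hS hfS hu₀ hu₀0 hu₀1 hσ.1 hσ.2

open ParabolicSL in
theorem theorem2p7 (p q : ℝ) (hp : 0 < p) (hq : -p * Real.pi ^ 2 < q)
    (u₀ : ℝ → ℝ) (hu₀ : MemH1 u₀) (hu₀0 : u₀ 0 = 0) (hu₀1 : u₀ 1 = 0)
    (τ : ℕ → ℝ) (f : ℝ → ℝ → ℝ) (hf : IsGDWith (dirichletOp p q hp) τ f)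
    (hfC1 : ∀ t, 0 ≤ t → ContDiffOn ℝ 1 (f t) (Set.Icc 0 1))
    (hf' : IsGD (dirichletOp p q hp) (spatialDeriv f) ∨ IsGD (neumannOp p q hp) (spatialDeriv f))
    (hf0 : IsGB (fun t => f t 0)) (hf1 : IsGB (fun t => f t 1))
    (u : ℝ → ℝ → ℝ)
    (hu : IsSolution (dirichletOp p q hp) τ f (fun _ => 0) (fun _ => 0) u₀ u)
    (σ : ℝ) (hσ : σ ∈ Set.Ico 0 (p * Real.pi ^ 2 + q)) (t : ℝ) (ht : 0 < t) :
    BddAbove (fadingValues f σ t) ∧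
    l2norm (u t) ≤ Real.exp (-(p * Real.pi ^ 2 + q) * t) * l2norm u₀
      + 1 / (p * Real.pi ^ 2 + q - σ) * sSup (fadingValues f σ t) ∧
    l2norm (spatialDeriv u t) ≤ Real.exp (-(p * Real.pi ^ 2 + q) * t) * l2norm (deriv u₀)
      + (p * Real.pi ^ 2 + q) / (p * Real.pi ^ 2 + q - σ) * p⁻¹ * gain (q / p)
        * sSup (fadingValues f σ t) :=
  have hbdd := hf.bddAbove_fadingValues σ t
  ⟨hbdd, theorem2p7_general p q hp u₀ hu₀ hu₀0 hu₀1 τ hf.1 f u hu σ hσ t ht hbdd⟩
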